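/- Let $n\ge 1$. A rational map $f:\mathbb P^{n-1}\dashrightarrow\mathbb P^{n-1}$ over $\mathbb C$ has degree $d$ if it can be written $f=[f_1:\dots:f_n]$ with forms $f_i$ of degree $d$ without common factor. A quadro-quadric Cremona transformation is a birational map $f$ of $\mathbb P^{n-1}$ such that $f$ and $f^{-1}$ both have degree $2$. Two such maps $f,f'$ are linearly equivalent if $f'=\ell_1\circ f\circ\ell_2$ for some projective transformations $\ell_1,\ell_2$ of $\mathbb P^{n-1}$. A Jordan algebra is a finite dimensional commutative (not necessarily associative) complex algebra $\mathbb J$ with unit $e$ such that $x^2(xy)=x(x^2y)$ for all $x,y\in\mathbb J$. It has rank $3$ if the subalgebra generated by $e$ and a general element $x\in\mathbb J$ has dimension $3$. For $\mathbb J$ of rank $3$, the generic trace $T$ (a linear form), the quadratic form $S$ and the generic norm $N$ (a cubic form) are the unique forms on $\mathbb J$ with $x^3-T(x)x^2+S(x)x-N(x)e=0$ for all $x$, and the adjoint is $x^\#=x^2-T(x)x+S(x)e$. **Theorem.** For every quadro-quadric Cremona transformation $f$ of $\mathbb P^{n-1}$ there is a Jordan algebra $\mathbb J_f$ of dimension $n$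 and rank $3$ such that, after identifying $\mathbb P(\mathbb J_f)$ with $\mathbb P^{n-1}$ through a basis of $\mathbb J_f$, the map $\#_{\mathbb J_f}:[x]\dashrightarrow[x^\#]$ is a quadro-quadric Cremona transformation linearly equivalent to $f$. In particular, every quadro-quadric Cremona transformation of $\mathbb P^{n-1}$ is linearly equivalent to an involution which is the adjoint of a rank $3$ Jordan algebra. -/

import Mathlib

/-- An `n`-tuple of homogeneous polynomials in `n` variables, all of the same degree `deg` and not
all zero: homogeneous coordinates `[F₁ : ⋯ : Fₙ]` of a rational self-map of `ℙⁿ⁻¹` over `ℂ`. -/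
structure HomTuple (n : ℕ) where
  deg : ℕ
  poly : Fin n → MvPolynomial (Fin n) ℂ
  homogeneous : ∀ i, (poly i).IsHomogeneous deg
  nonzero : ∃ i, poly i ≠ 0

/-- Two tuples define the same rational map when they are proportional over the field of rational
functions, that is, when all `2 × 2` minors vanish. -/
instance HomTuple.instSetoid (n : ℕ) : Setoid (HomTuple n) where
  r F G := ∀ i j, F.poly i * G.poly j = F.poly j * G.poly i
  iseqv := by
    refine ⟨fun F i j => mul_comm _ _, fun {F G} h i j => ?_, fun {F G H} h₁ h₂ i j => ?_⟩
    · have h' := h j i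
      rw [mul_comm (G.poly i), mul_comm (G.poly j)]
      exact h'
    · obtain ⟨k, hk⟩ := G.nonzero
      apply mul_left_cancel₀ hk
      linear_combination H.poly j * h₁ i k - H.poly i * h₁ j k + F.poly k * h₂ i j

/-- Rational maps `ℙⁿ⁻¹ ⇢ ℙⁿ⁻¹` over `ℂ`. -/
def RatMap (n : ℕ) : Type := Quotient (HomTuple.instSetoid n)

/-- The rational map with given homogeneous coordinates. -/
def HomTuple.toRatMap {n : ℕ} (F : HomTuple n) : RatMap n := Quotient.mk _ F

/-- Substitution of one tuple into another, `(G ∘ F)ᵢ = Gᵢ(F₁, …, Fₙ)`, when the result does not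
vanish identically. -/
noncomputable def HomTuple.comp {n : ℕ} (G F : HomTuple n)
    (h : ∃ i, MvPolynomial.bind₁ F.poly (G.poly i) ≠ 0) : HomTuple n where
  deg := F.deg * G.deg
  poly i := MvPolynomial.bind₁ F.poly (G.poly i)
  homogeneous i := (G.homogeneous i).aeval F.poly F.homogeneous
  nonzero := h

/-- The projective transformation of `ℙⁿ⁻¹` given by an invertible matrix. -/
noncomputable def HomTuple.ofMatrix {n : ℕ} [NeZero n] (A : GL (Fin n) ℂ) : HomTuple n where
  deg := 1
  poly i := ∑ j, MvPolynomial.C (A.1 i j) * MvPolynomial.X j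
  homogeneous i := MvPolynomial.IsHomogeneous.sum _ _ _ fun j _ =>
    (zero_add 1 : 0 + 1 = 1) ▸
      (MvPolynomial.isHomogeneous_C _ _).mul (MvPolynomial.isHomogeneous_X _ _)
  nonzero := by
    by_contra! h
    have hA : A.1 = 0 := by
      ext i j
      have := congrArg (MvPolynomial.eval (Pi.single j 1)) (h i)
      simpa [Pi.single_apply] using this
    exact A.ne_zero hA

namespace RatMap

variable {n : ℕ}

/-- `k = g ∘ f` as rational maps (in particular, the composition is defined). -/
def IsComp (g f k : RatMap n) : Prop :=
  ∃ (G F : HomTuple n) (h : ∃ i, MvPolynomial.bind₁ F.poly (G.poly i) ≠ 0),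
    G.toRatMap = g ∧ F.toRatMap = f ∧ (G.comp F h).toRatMap = k

/-- A projective transformation, as a rational map. -/
noncomputable def linear [NeZero n] (A : GL (Fin n) ℂ) : RatMap n :=
  (HomTuple.ofMatrix A).toRatMap

/-- The identity of `ℙⁿ⁻¹`. -/
noncomputable def identity (n : ℕ) [NeZero n] : RatMap n := linear 1

/-- `f` and `g` are birational maps inverse to each other. -/
def IsInverse [NeZero n] (f g : RatMap n) : Prop :=
  IsComp g f (identity n) ∧ IsComp f g (identity n)

/-- `f` has degree `d`: it is given by forms of degree `d` without common factor. -/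
def HasDegree (f : RatMap n) (d : ℕ) : Prop :=
  ∃ F : HomTuple n, F.toRatMap = f ∧ F.deg = d ∧ ∀ h, (∀ i, h ∣ F.poly i) → IsUnit h

/-- `f` is a Cremona transformation of bidegree `(2, 2)`. -/
def IsQuadroQuadric [NeZero n] (f : RatMap n) : Prop :=
  ∃ g : RatMap n, IsInverse f g ∧ HasDegree f 2 ∧ HasDegree g 2

/-- `f' = ℓ₁ ∘ f ∘ ℓ₂` for some projective transformations `ℓ₁`, `ℓ₂`. -/
def LinearlyEquivalent [NeZero n] (f f' : RatMap n) : Prop :=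
  ∃ (A B : GL (Fin n) ℂ) (k : RatMap n), IsComp f (linear B) k ∧ IsComp (linear A) k f'

end RatMap

section Jordan

variable (J : Type) [NonAssocCommRing J] [Module ℂ J]

/-- `P` holds for a general element: it holds on the nonvanishing locus of some polynomial
function that is not identically zero. -/
def HoldsGenerally {J : Type} [AddCommGroup J] [Module ℂ J] (P : J → Prop) : Prop :=
  ∃ p : MvPolynomial (Module.Dual ℂ J) ℂ,
    (∃ x : J, MvPolynomial.eval (fun φ => φ x) p ≠ 0) ∧
      ∀ x : J, MvPolynomial.eval (fun φ => φ x) p ≠ 0 → P x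

/-- The algebra `J` has rank `r`: the subalgebra generated by the unit and a general element has
dimension `r`. -/
def HasRank [IsScalarTower ℂ J J] [SMulCommClass ℂ J J] (r : ℕ) : Prop :=
  HoldsGenerally fun x : J => Module.finrank ℂ (NonUnitalAlgebra.adjoin ℂ ({1, x} : Set J)) = r

/-- The generic trace `T` (a linear form), the quadratic form `S` and the generic norm `N` (a cubic
form) of a Jordan algebra `J` of rank 3, characterized by `x³ - T(x) x² + S(x) x - N(x) 1 = 0`
for all `x`. When `J` has rank 3 they are unique, as `1, x, x²` are independent for general `x`. -/
structure GenericCubic where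
  T : J →ₗ[ℂ] ℂ
  S : QuadraticForm ℂ J
  N : J → ℂ
  cubic : ∃ τ : MultilinearMap ℂ (fun _ : Fin 3 => J) ℂ, ∀ x, N x = τ fun _ => x
  equation : ∀ x, x * (x * x) - T x • (x * x) + S x • x - N x • (1 : J) = 0

variable {J}

/-- The adjoint `x^# = x² - T(x) x + S(x) 1`. -/
def GenericCubic.adjoint (D : GenericCubic J) (x : J) : J :=
  x * x - D.T x • x + D.S x • (1 : J)

/-- `σ` is the rational map `[x] ⇢ [x^#]` of `ℙ(J)`, where `ℙ(J)` is identified with `ℙⁿ⁻¹` by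
means of the basis `b` of `J`. -/
def GenericCubic.IsAdjointMap {n : ℕ} (D : GenericCubic J) (b : Module.Basis (Fin n) ℂ J)
    (σ : RatMap n) : Prop :=
  ∃ F : HomTuple n, F.toRatMap = σ ∧
    ∀ (x : J) (i : Fin n), MvPolynomial.eval (b.repr x) (F.poly i) = b.repr (D.adjoint x) i

end Jordan

/-! Write `f` and its inverse by coprime quadratic tuples `F` and `G`. Then `G ∘ F = N • x` and `F ∘
G = M • x` for cubic forms `N`, `M`, so `F / N` is homogeneous of degree `-1`, like inversion in an
algebra. The proof makes it an inversion.

Choose `e` with `N e = 1`, let `-K` be the derivative of `F / N` at `e`, and replace `F` by `K⁻¹ ∘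
F` and `G` by `G ∘ K`. Now `F / N` fixes `e` with derivative `-1` there (`twist_isNormalizedAt`).
Expanding `G ∘ F = N • x` to second order at `e` then forces `G = F` (`B_self`, `B_eq`), hence `M =
N`: `F` has become an adjoint, with `x^## = N(x) x`.

The trace form comes from coprimality: `N` divides the partial derivatives of `M` at `F`, with
linear quotients (`exists_trace`). After normalization it is symmetric (`T_comm`). The identities
obtained are collected in `CubicNorm`. The product is found by solving `x^# = x² - T(x) x + S(x) e`
for `x²` and polarizing. The Jordan identity reduces to the commutation of multiplication by `x` and
by `x^#`, which follows from two linearized adjoint identities (`mul_mul_B_self`).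

The rank is 3 because, if `e`, `x`, `x^#` were always dependent, the coordinates of `x^#` would
share a linear factor (`exists_factor_of_dependent`), against coprimality. -/

open MvPolynomial

/-! ### Divisibility, the chain rule and polarization for homogeneous polynomials -/

section Polynomials

variable {σ : Type*}

/-- If the `F i` have no common factor and `a` divides all `b * F i`, then `a` divides `b`. -/
theorem MvPolynomial.dvd_of_forall_dvd_mul {ι : Type*} [Fintype ι] {F : ι → MvPolynomial σ ℂ}
    (hF : ∀ h, (∀ i, h ∣ F i) → IsUnit h) {a b : MvPolynomial σ ℂ}
    (h : ∀ i, a ∣ b * F i) : a ∣ b := by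
  let _ : NormalizationMonoid (MvPolynomial σ ℂ) := Nonempty.some inferInstance
  let _ := UniqueFactorizationMonoid.toNormalizedGCDMonoid (MvPolynomial σ ℂ)
  have : a ∣ Finset.univ.gcd fun i => b * F i := Finset.dvd_gcd fun i _ => h i
  have h2 := this.trans (Finset.gcd_mul_left' Finset.univ F b).dvd
  exact (hF _ fun i => Finset.gcd_dvd (Finset.mem_univ i)).dvd_mul_right.1 h2

/-- A tuple proportional to one without common factor is a multiple of it. -/
theorem MvPolynomial.exists_eq_mul_of_proportional {ι : Type*} [Fintype ι]
    {F H : ι → MvPolynomial σ ℂ} (hF : ∀ h, (∀ i, h ∣ F i) → IsUnit h) (hF0 : ∃ i, F i ≠ 0)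
    (h : ∀ i j, H i * F j = H j * F i) : ∃ p, ∀ i, H i = p * F i := by
  obtain ⟨j, hj⟩ := hF0
  obtain ⟨p, hp⟩ : F j ∣ H j := dvd_of_forall_dvd_mul hF fun i => ⟨H i, by rw [← h, mul_comm]⟩
  refine ⟨p, fun i => mul_right_cancel₀ hj ?_⟩
  rw [h, hp]
  ring

/-- The component of degree `m + k` of `a * b` is `a` times the component of degree `k` of `b`;
cancel `a`. -/
theorem MvPolynomial.IsHomogeneous.of_mul_left {a b : MvPolynomial σ ℂ} {m k : ℕ}
    (ha : a.IsHomogeneous m) (ha0 : a ≠ 0) (hab : (a * b).IsHomogeneous (m + k)) :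
    b.IsHomogeneous k := by
  let _ := MvPolynomial.gradedAlgebra (σ := σ) (R := ℂ)
  have h := DirectSum.coe_decompose_mul_add_of_left_mem (homogeneousSubmodule σ ℂ)
    (j := k) (b := b) ((mem_homogeneousSubmodule m a).2 ha)
  rw [DirectSum.decompose_of_mem_same _ ((mem_homogeneousSubmodule _ _).2 hab)] at h
  rw [mul_left_cancel₀ ha0 h]
  exact (mem_homogeneousSubmodule _ _).1 (SetLike.coe_mem _)

theorem MvPolynomial.pderiv_bind₁ {τ : Type*} [Fintype σ] (G : σ → MvPolynomial τ ℂ)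
    (k : τ) (p : MvPolynomial σ ℂ) :
    pderiv k (bind₁ G p) = ∑ j, bind₁ G (pderiv j p) * pderiv k (G j) := by
  classical
  induction p using MvPolynomial.induction_on with
  | C a => simp
  | add p q hp hq => simp [hp, hq, add_mul, Finset.sum_add_distrib]
  | mul_X p i hp =>
    simp only [map_mul, bind₁_X_right, Derivation.leibniz, smul_eq_mul, hp, pderiv_X, map_add,
      add_mul, Finset.sum_add_distrib, Finset.mul_sum]
    congr 1
    · rw [Finset.sum_eq_single i (fun j _ hj => by simp [hj.symm]) (by simp)]
      simp
    · simp only [mul_assoc]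

theorem MvPolynomial.IsHomogeneous.bind₁_mul {p : MvPolynomial σ ℂ} {d : ℕ}
    (hp : p.IsHomogeneous d) {τ : Type*} (r : MvPolynomial τ ℂ) (f : σ → MvPolynomial τ ℂ) :
    bind₁ (fun i => r * f i) p = r ^ d * bind₁ f p := by
  simp only [bind₁, aeval_def, eval₂_eq, Finset.mul_sum]
  refine Finset.sum_congr rfl fun s hs => ?_
  rw [hp.degree_eq_sum_deg_support hs]
  simp only [mul_pow, Finset.prod_mul_distrib, Finset.prod_pow_eq_pow_sum]
  ring

variable {n : ℕ}

theorem MvPolynomial.IsHomogeneous.exists_linearMap {p : MvPolynomial (Fin n) ℂ}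
    (hp : p.IsHomogeneous 1) : ∃ l : (Fin n → ℂ) →ₗ[ℂ] ℂ, ∀ x, l x = eval x p := by
  have h := hp.sum_X_mul_pderiv
  have hc : ∀ i, ∃ c, pderiv i p = C c := fun i =>
    ⟨_, (totalDegree_eq_zero_iff_eq_C.1 ((totalDegree_zero_iff_isHomogeneous _).2 hp.pderiv))⟩
  choose c hc using hc
  refine ⟨∑ i, c i • LinearMap.proj i, fun x => ?_⟩
  have := congrArg (eval x) h
  simp [hc] at this
  simp [← this, mul_comm]

theorem MvPolynomial.IsHomogeneous.exists_bilinearMap {p : MvPolynomial (Fin n) ℂ}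
    (hp : p.IsHomogeneous 2) : ∃ B : (Fin n → ℂ) →ₗ[ℂ] (Fin n → ℂ) →ₗ[ℂ] ℂ,
      (∀ x y, B x y = B y x) ∧ ∀ x, B x x = eval x p := by
  have h := hp.sum_X_mul_pderiv
  choose l hl using fun i => (hp.pderiv (i := i)).exists_linearMap
  let B : (Fin n → ℂ) →ₗ[ℂ] (Fin n → ℂ) →ₗ[ℂ] ℂ :=
    ∑ i, (LinearMap.proj i : (Fin n → ℂ) →ₗ[ℂ] ℂ).smulRight (l i)
  have hB : ∀ x y, B x y = ∑ i, x i * l i y := by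
    intro x y
    simp [B, LinearMap.sum_apply]
  -- By Euler, `B x x = 2 p(x)`, and symmetrizing doubles this again.
  refine ⟨(4⁻¹ : ℂ) • (B + B.flip), fun x y => ?_, fun x => ?_⟩
  · simp [add_comm]
  · have := congrArg (eval x) h
    simp only [map_sum, map_mul, eval_X, ← hl, ← hB] at this
    simp [this]
    ring

theorem MvPolynomial.pderiv_comm (i j : Fin n) (p : MvPolynomial (Fin n) ℂ) :
    pderiv i (pderiv j p) = pderiv j (pderiv i p) := by
  induction p using MvPolynomial.induction_on with
  | C a => simp
  | add p q hp hq => simp [hp, hq]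
  | mul_X p k hp =>
    have h : ∀ a b : Fin n, pderiv a (pderiv b (X k : MvPolynomial (Fin n) ℂ)) = 0 := by
      intro a b
      rw [pderiv_X]
      by_cases hb : b = k
      · subst hb
        simp
      · simp [Ne.symm hb]
    simp only [Derivation.leibniz, smul_eq_mul, map_add, hp, h]
    ring

theorem MvPolynomial.IsHomogeneous.exists_trilinearMap {p : MvPolynomial (Fin n) ℂ}
    (hp : p.IsHomogeneous 3) :
    ∃ B : (Fin n → ℂ) →ₗ[ℂ] (Fin n → ℂ) →ₗ[ℂ] (Fin n → ℂ) →ₗ[ℂ] ℂ,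
      (∀ x y z, B x y z = B y x z) ∧ (∀ x y z, B x y z = B x z y) ∧
      (∀ x, B x x x = eval x p) ∧
      ∀ x v, 3 * B x x v = ∑ i, v i * eval x (pderiv i p) := by
  have hc : ∀ i j k, ∃ c, pderiv i (pderiv j (pderiv k p)) = C c := fun i j k =>
    ⟨_, (totalDegree_eq_zero_iff_eq_C.1
      ((totalDegree_zero_iff_isHomogeneous _).2 hp.pderiv.pderiv.pderiv))⟩
  choose c hc using hc
  have h1 : ∀ i j k, c i j k = c j i k := fun i j k =>
    C_injective (Fin n) ℂ (by rw [← hc, ← hc, pderiv_comm])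
  have h2 : ∀ i j k, c i j k = c i k j := fun i j k =>
    C_injective (Fin n) ℂ (by rw [← hc, ← hc, pderiv_comm j])
  let pr : Fin n → (Fin n → ℂ) →ₗ[ℂ] ℂ := fun i => LinearMap.proj i
  -- The constant third partials give `6 p` on the diagonal, by Euler's identity in degrees 3, 2 and
  -- 1.
  let B : (Fin n → ℂ) →ₗ[ℂ] (Fin n → ℂ) →ₗ[ℂ] (Fin n → ℂ) →ₗ[ℂ] ℂ :=
    (6⁻¹ : ℂ) • ∑ k, (pr k).smulRight (∑ j, (pr j).smulRight (∑ i, c i j k • pr i))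
  have hB : ∀ x y z, 6 * B x y z = ∑ k, ∑ j, ∑ i, x k * (y j * (c i j k * z i)) := by
    intro x y z
    simp [B, pr, LinearMap.sum_apply, Finset.mul_sum]
  have e2 : ∀ j k x, eval x (pderiv j (pderiv k p)) = ∑ i, c i j k * x i := by
    intro j k x
    have := congrArg (eval x) (hp.pderiv (i := k) |>.pderiv (i := j)).sum_X_mul_pderiv
    simpa [hc, mul_comm, eq_comm] using this
  have e1 : ∀ k x, 2 * eval x (pderiv k p) = ∑ j, x j * ∑ i, c i j k * x i := by
    intro k x
    have := congrArg (eval x) (hp.pderiv (i := k)).sum_X_mul_pderiv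
    simpa [e2, eq_comm] using this
  have e0 : ∀ x, 3 * eval x p = ∑ k, x k * eval x (pderiv k p) := by
    intro x
    have := congrArg (eval x) hp.sum_X_mul_pderiv
    simpa [eq_comm] using this
  have s1 : ∀ x y z, B x y z = B y x z := by
    intro x y z
    apply mul_left_cancel₀ (show (6 : ℂ) ≠ 0 by norm_num)
    rw [hB, hB, Finset.sum_comm]
    refine Finset.sum_congr rfl fun k _ => Finset.sum_congr rfl fun j _ =>
      Finset.sum_congr rfl fun i _ => ?_
    rw [h2]
    ring
  have s2 : ∀ x y z, B x y z = B x z y := by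
    intro x y z
    apply mul_left_cancel₀ (show (6 : ℂ) ≠ 0 by norm_num)
    rw [hB, hB]
    refine Finset.sum_congr rfl fun k _ => ?_
    rw [Finset.sum_comm]
    refine Finset.sum_congr rfl fun j _ => Finset.sum_congr rfl fun i _ => ?_
    rw [h1]
    ring
  have s3 : ∀ x v, 3 * B x x v = ∑ i, v i * eval x (pderiv i p) := by
    intro x v
    apply mul_left_cancel₀ (show (2 : ℂ) ≠ 0 by norm_num)
    rw [s2, s1, ← mul_assoc, show (2 : ℂ) * 3 = 6 by norm_num, hB, Finset.mul_sum]
    refine Finset.sum_congr rfl fun k _ => ?_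
    rw [mul_left_comm, e1, Finset.mul_sum]
    simp [Finset.mul_sum]
  refine ⟨B, s1, s2, fun x => ?_, s3⟩
  apply mul_left_cancel₀ (show (3 : ℂ) ≠ 0 by norm_num)
  rw [s3, e0]

end Polynomials

/-! ### From a birational map to a pair of quadratic tuples -/

section Cremona

variable {n : ℕ}

/-- Coordinates `F`, `G` of two mutually inverse quadratic Cremona transformations, together with
the cubic forms `N`, `M` with `G ∘ F = N • X` and `F ∘ G = M • X`. -/
structure QuadraticInversePair (F G : Fin n → MvPolynomial (Fin n) ℂ)
    (N M : MvPolynomial (Fin n) ℂ) : Prop where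
  homF : ∀ i, (F i).IsHomogeneous 2
  homG : ∀ i, (G i).IsHomogeneous 2
  homN : N.IsHomogeneous 3
  homM : M.IsHomogeneous 3
  coprime : ∀ h, (∀ i, h ∣ F i) → IsUnit h
  ne_zero : N ≠ 0
  comp_left : ∀ i, bind₁ F (G i) = N * X i
  comp_right : ∀ i, bind₁ G (F i) = M * X i

theorem isUnit_of_dvd_X (hn : 2 ≤ n) (h : MvPolynomial (Fin n) ℂ) (hd : ∀ i, h ∣ X i) :
    IsUnit h := by
  have h0 := hd ⟨0, by omega⟩
  have h1 := hd ⟨1, by omega⟩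
  rcases (X_prime (R := ℂ) (i := (⟨0, by omega⟩ : Fin n))).irreducible.dvd_iff.1 h0 with h' | h'
  · exact h'
  · exfalso
    have h2 := h'.dvd.trans h1
    rw [X_dvd_X] at h2
    simp at h2

/-- On a point the only form divides itself, so coprimality would make a quadratic form a unit. -/
theorem two_le_of_coprime {F : Fin n → MvPolynomial (Fin n) ℂ} (hF : ∀ i, (F i).IsHomogeneous 2)
    (hF0 : ∃ i, F i ≠ 0) (hc : ∀ h, (∀ i, h ∣ F i) → IsUnit h) : 2 ≤ n := by
  by_contra! hn
  obtain ⟨i, hi⟩ := hF0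
  have hu : IsUnit (F i) := hc _ fun j => by
    rw [show j = i from Fin.ext (by omega)]
  obtain ⟨c, hc⟩ := (isUnit_iff_eq_C_of_isReduced.1 hu)
  have := (hF i).totalDegree hi
  rw [hc.2, totalDegree_C] at this
  omega

theorem ofMatrix_one_poly [NeZero n] (i : Fin n) :
    (HomTuple.ofMatrix (1 : GL (Fin n) ℂ)).poly i = X i := by
  simp [HomTuple.ofMatrix, Matrix.one_apply]

/-- If coprime tuples `F`, `G` of quadratic forms represent `f`, `g` and `g ∘ f` is the identity,
then `G ∘ F` is a cubic form times the tuple of coordinates. -/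
theorem exists_cubic_of_isComp [NeZero n] (hn : 2 ≤ n) {F G : HomTuple n}
    (hF : ∀ h, (∀ i, h ∣ F.poly i) → IsUnit h) (hG : ∀ h, (∀ i, h ∣ G.poly i) → IsUnit h)
    (dF : F.deg = 2) (dG : G.deg = 2)
    (h : RatMap.IsComp G.toRatMap F.toRatMap (RatMap.identity n)) :
    ∃ N : MvPolynomial (Fin n) ℂ, N.IsHomogeneous 3 ∧ N ≠ 0 ∧
      ∀ i, bind₁ F.poly (G.poly i) = N * X i := by
  obtain ⟨G', F', ⟨i₀, h0⟩, hG', hF', hGF⟩ := h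
  have hG2 : ∀ i j, G'.poly i * G.poly j = G'.poly j * G.poly i := Quotient.exact hG'
  have hF2 : ∀ i j, F'.poly i * F.poly j = F'.poly j * F.poly i := Quotient.exact hF'
  have hGF2 : ∀ i j, bind₁ F'.poly (G'.poly i) * X j = bind₁ F'.poly (G'.poly j) * X i := by
    intro i j
    have : ∀ i j, bind₁ F'.poly (G'.poly i) * (HomTuple.ofMatrix (1 : GL (Fin n) ℂ)).poly j =
      bind₁ F'.poly (G'.poly j) * (HomTuple.ofMatrix (1 : GL (Fin n) ℂ)).poly i :=
      Quotient.exact hGF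
    simpa only [ofMatrix_one_poly] using this i j
  obtain ⟨k, hk⟩ := exists_eq_mul_of_proportional hG G.nonzero hG2
  obtain ⟨l, hl⟩ := exists_eq_mul_of_proportional hF F.nonzero hF2
  have hom : ∀ i, (G.poly i).IsHomogeneous 2 := fun i => dG ▸ G.homogeneous i
  -- The representatives witnessing the composition need not be coprime: `G' = k G` and `F' = l F`.
  -- As `G` is quadratic, `l` comes out squared.
  have key : ∀ i, bind₁ F'.poly (G'.poly i) =
      (bind₁ F'.poly k * l ^ 2) * bind₁ F.poly (G.poly i) := by
    intro i
    rw [hk, map_mul, mul_assoc]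
    congr 1
    rw [← (hom i).bind₁_mul]
    congr 2
    funext j
    exact hl j
  have hne : bind₁ F'.poly k * l ^ 2 ≠ 0 := fun h => h0 (by rw [key, h, zero_mul])
  have hprop : ∀ i j, bind₁ F.poly (G.poly i) * X j = bind₁ F.poly (G.poly j) * X i := by
    intro i j
    apply mul_left_cancel₀ hne
    rw [← mul_assoc, ← key, ← mul_assoc, ← key, hGF2]
  obtain ⟨N, hN⟩ := exists_eq_mul_of_proportional (isUnit_of_dvd_X hn) ⟨i₀, X_ne_zero i₀⟩ hprop
  refine ⟨N, ?_, ?_, hN⟩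
  · apply IsHomogeneous.of_mul_left (isHomogeneous_X ℂ i₀) (X_ne_zero i₀)
    rw [mul_comm, ← hN]
    exact (hom i₀).aeval F.poly fun i => dF ▸ F.homogeneous i
  · rintro rfl
    apply h0
    rw [key, hN, zero_mul, mul_zero]

theorem RatMap.IsQuadroQuadric.exists_pair [NeZero n] {f : RatMap n} (hf : f.IsQuadroQuadric) :
    ∃ (F : HomTuple n) (G : Fin n → MvPolynomial (Fin n) ℂ) (N M : MvPolynomial (Fin n) ℂ),
      F.toRatMap = f ∧ QuadraticInversePair F.poly G N M := by
  obtain ⟨g, ⟨h2, h1⟩, ⟨F, rfl, dF, cF⟩, ⟨G, rfl, dG, cG⟩⟩ := hf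
  have homF : ∀ i, (F.poly i).IsHomogeneous 2 := fun i => dF ▸ F.homogeneous i
  have homG : ∀ i, (G.poly i).IsHomogeneous 2 := fun i => dG ▸ G.homogeneous i
  have hn := two_le_of_coprime homF F.nonzero cF
  obtain ⟨N, hN, hN0, hGF⟩ := exists_cubic_of_isComp hn cF cG dF dG h2
  obtain ⟨M, hM, -, hFG⟩ := exists_cubic_of_isComp hn cG cF dG dF h1
  exact ⟨F, G.poly, N, M, rfl, homF, homG, hN, hM, cF, hN0, hGF, hFG⟩

namespace QuadraticInversePair

variable {F G : Fin n → MvPolynomial (Fin n) ℂ} {N M : MvPolynomial (Fin n) ℂ}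

/-- Evaluate `F ∘ G ∘ F` in two ways: as `M(F) F` and as `F(N x) = N² F`. -/
theorem bind₁_norm (h : QuadraticInversePair F G N M) (hF0 : ∃ i, F i ≠ 0) :
    bind₁ F M = N ^ 2 := by
  obtain ⟨i, hi⟩ := hF0
  apply mul_right_cancel₀ hi
  have := congrArg (bind₁ F) (h.comp_right i)
  rw [map_mul, bind₁_X_right, bind₁_bind₁] at this
  rw [← this]
  have e : (fun i => bind₁ F (G i)) = fun i => N * X i := funext h.comp_left
  rw [e, (h.homF i).bind₁_mul]
  simp

/-- The norm `N` divides the partial derivatives of `M` at `F`, the quotients being linear. -/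
theorem exists_trace (h : QuadraticInversePair F G N M) (hF0 : ∃ i, F i ≠ 0) (k : Fin n) :
    ∃ t : MvPolynomial (Fin n) ℂ, t.IsHomogeneous 1 ∧ bind₁ F (pderiv k M) = N * t := by
  have hdvd : N ∣ bind₁ F (pderiv k M) := by
    refine dvd_of_forall_dvd_mul h.coprime fun i => ?_
    -- Differentiate `Fᵢ ∘ G = M xᵢ` and substitute `F`. The chain rule side is divisible by `N`,
    -- and so is `M(F) = N²`; hence `N` divides `Fᵢ · (∂ₖM)(F)` for every `i`, and coprimality
    -- removes `Fᵢ`.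
    have h1 := congrArg (bind₁ F) (congrArg (pderiv k) (h.comp_right i))
    rw [pderiv_bind₁, Derivation.leibniz, smul_eq_mul, smul_eq_mul, map_add, map_mul, map_mul,
      h.bind₁_norm hF0, bind₁_X_right, map_sum] at h1
    have h2 : ∀ j, bind₁ F (bind₁ G (pderiv j (F i))) = N * pderiv j (F i) := by
      intro j
      have e : (fun i => bind₁ F (G i)) = fun i => N * X i := funext h.comp_left
      rw [bind₁_bind₁, e, ((h.homF i).pderiv (i := j)).bind₁_mul]
      simp
    have h3 : N ∣ ∑ j, bind₁ F (bind₁ G (pderiv j (F i)) * pderiv k (G j)) :=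
      Finset.dvd_sum fun j _ => by
        rw [map_mul, h2]
        exact Dvd.dvd.mul_right (dvd_mul_right _ _) _
    rw [h1] at h3
    rw [mul_comm]
    exact (dvd_add_right (Dvd.dvd.mul_right (dvd_pow_self _ two_ne_zero) _)).1 h3
  obtain ⟨t, ht⟩ := hdvd
  refine ⟨t, ?_, ht⟩
  apply h.homN.of_mul_left h.ne_zero
  rw [← ht]
  exact (h.homM.pderiv (i := k)).aeval F h.homF

end QuadraticInversePair

end Cremona

/-! ### Polarized identities and normalization at a base point -/

section Multilinear

variable {V : Type*} [NormedAddCommGroup V] [NormedSpace ℂ V]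

@[fun_prop]
theorem LinearMap.continuous_bilinear [FiniteDimensional ℂ V] {X W : Type*} [TopologicalSpace X]
    [NormedAddCommGroup W] [NormedSpace ℂ W]
    (B : V →ₗ[ℂ] V →ₗ[ℂ] W) {f g : X → V} (hf : Continuous f) (hg : Continuous g) :
    Continuous fun x => B (f x) (g x) := by
  have : Continuous fun p : V × V => B.toContinuousBilinearMap p.1 p.2 :=
    B.toContinuousBilinearMap.continuous₂
  exact this.comp (hf.prodMk hg)

@[fun_prop]
theorem LinearMap.continuous_trilinear [FiniteDimensional ℂ V] {X : Type*} [TopologicalSpace X]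
    (B : V →ₗ[ℂ] V →ₗ[ℂ] V →ₗ[ℂ] ℂ) {f g h : X → V} (hf : Continuous f) (hg : Continuous g)
    (hh : Continuous h) : Continuous fun x => B (f x) (g x) (h x) := by
  have h1 : Continuous fun x => (B (f x) (g x)).toContinuousLinearMap :=
    (B.compr₂ (LinearMap.toContinuousLinearMap : _ ≃ₗ[ℂ] (V →L[ℂ] ℂ)).toLinearMap
      ).continuous_bilinear hf hg
  exact h1.clm_apply hh

/-- Two mutually inverse quadratic maps `x ↦ A x x`, `x ↦ B x x` in polarized form, with the cubic
forms `N`, `M` such that `B (A x x) (A x x) = N x x x • x` and `A (B x x) (B x x) = M x x x • x`,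
and the bilinear form `T x w = ∂_w M (A x x) / N x x x`. -/
structure InverseQuadraticMaps (V : Type*) [NormedAddCommGroup V] [NormedSpace ℂ V] where
  A : V →ₗ[ℂ] V →ₗ[ℂ] V
  B : V →ₗ[ℂ] V →ₗ[ℂ] V
  N : V →ₗ[ℂ] V →ₗ[ℂ] V →ₗ[ℂ] ℂ
  M : V →ₗ[ℂ] V →ₗ[ℂ] V →ₗ[ℂ] ℂ
  T : V →ₗ[ℂ] V →ₗ[ℂ] ℂ
  A_comm : ∀ x y, A x y = A y x
  B_comm : ∀ x y, B x y = B y x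
  N_comm : ∀ x y z, N x y z = N y x z
  N_right_comm : ∀ x y z, N x y z = N x z y
  M_comm : ∀ x y z, M x y z = M y x z
  M_right_comm : ∀ x y z, M x y z = M x z y
  B_A : ∀ x, B (A x x) (A x x) = N x x x • x
  A_B : ∀ x, A (B x x) (B x x) = M x x x • x
  M_A : ∀ x, M (A x x) (A x x) (A x x) = N x x x ^ 2
  M_T : ∀ x w, 3 * M (A x x) (A x x) w = N x x x * T x w
  dense : Dense {x | N x x x ≠ 0}

/-- A cubic form with adjoint `x ↦ B x x`, trace form `T` and base point `e`; the cubic form is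
`x ↦ T x (B x x) / 3`. -/
structure CubicNorm (V : Type*) [AddCommGroup V] [Module ℂ V] where
  B : V →ₗ[ℂ] V →ₗ[ℂ] V
  T : V →ₗ[ℂ] V →ₗ[ℂ] ℂ
  e : V
  B_comm : ∀ x y, B x y = B y x
  T_comm : ∀ x y, T x y = T y x
  T_B : ∀ x y z, T (B x y) z = T (B x z) y
  B_B : ∀ x, B (B x x) (B x x) = (T x (B x x) / 3) • x
  B_B_deriv : ∀ x y, (4 : ℂ) • B (B x x) (B x y) = (T x (B x x) / 3) • y + T (B x x) y • x
  B_B_deriv' : ∀ x y, (4 : ℂ) • B x (B (B x x) y) = (T x (B x x) / 3) • y + T x y • B x x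
  B_e : ∀ x, (2 : ℂ) • B e x = T e x • e - x
  T_e_e : T e e = 3

namespace InverseQuadraticMaps

section

variable (D : InverseQuadraticMaps V)

/-- A factor `N x x x` can be cancelled where it does not vanish, and continuity extends the
identity from this dense set. -/
theorem cancel {W : Type*} [NormedAddCommGroup W] [NormedSpace ℂ W] {f g : V → W}
    (hf : Continuous f) (hg : Continuous g) (h : ∀ x, D.N x x x • f x = D.N x x x • g x) (x : V) :
    f x = g x :=
  congrFun (hf.ext_on D.dense hg fun x hx => smul_right_injective W hx (h x)) x

theorem B_A_deriv (x v : V) :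
    (4 : ℂ) • D.B (D.A x x) (D.A x v) = D.N x x x • v + (3 * D.N x x v) • x := by
  have h := fun t : ℂ => D.B_A (x + t • v)
  simp only [map_add, map_smul, LinearMap.add_apply, LinearMap.smul_apply, D.A_comm v x,
    D.N_comm v x, D.N_right_comm x v x, D.N_right_comm v v x] at h
  simp only [D.B_comm (D.A x v) (D.A x x)] at h
  -- The five-point difference formula for the derivative at `t = 0`, exact in degree at most 4.
  linear_combination (norm := module) (2 / 3 : ℂ) • (h 1 - h (-1)) - (1 / 12 : ℂ) • (h 2 - h (-2))

theorem B_A_deriv₂ (x u v : V) :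
    (4 : ℂ) • D.B (D.A x x) (D.A u v) + (8 : ℂ) • D.B (D.A x u) (D.A x v) =
      (3 * D.N x x u) • v + (6 * D.N x u v) • x + (3 * D.N x x v) • u := by
  have h := fun t : ℂ => D.B_A_deriv (x + t • u) v
  have hu := D.B_A_deriv u v
  simp only [map_add, map_smul, LinearMap.add_apply, LinearMap.smul_apply, D.A_comm u x,
    D.N_comm u x, D.N_right_comm x u x, D.N_right_comm u u x] at h hu
  -- The odd part at `t = 1` is the sum of the coefficients of `t` and `t³`; the latter is `hu`.
  linear_combination (norm := module) (1 / 2 : ℂ) • (h 1 - h (-1)) - hu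

variable [FiniteDimensional ℂ V]

/-- Differentiating `M(A x x) = N(x)²` along `v` and using `M_T` with `w = A x v` gives the identity
multiplied by `N(x)`. -/
theorem T_A_self (x v : V) : D.T x (D.A x v) = 3 * D.N x x v := by
  refine D.cancel (f := fun x => D.T x (D.A x v)) (g := fun x => 3 * D.N x x v)
    (by fun_prop) (by fun_prop) (fun x => ?_) x
  have h := fun t : ℂ => D.M_A (x + t • v)
  simp only [map_add, map_smul, LinearMap.add_apply, LinearMap.smul_apply, D.A_comm v x,
    D.N_comm v x, D.N_right_comm x v x, D.N_right_comm v v x,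
    smul_eq_mul] at h
  have h2 := D.M_T x (D.A x v)
  simp only [smul_eq_mul]
  generalize D.A x x = p, D.A x v = q, D.A v v = r at h h2 ⊢
  simp only [D.M_comm q p, D.M_right_comm p q p, D.M_right_comm q q p, D.M_comm r p,
    D.M_right_comm p r, D.M_comm r q, D.M_right_comm q r] at h h2 ⊢
  generalize D.M p p p = m₀, D.M p p q = m₁, D.M p p r = m₂, D.M p q q = m₃, D.M p q r = m₄,
    D.M p r r = m₅, D.M q q q = m₆, D.M q q r = m₇, D.M q r r = m₈, D.M r r r = m₉,
    D.N x x x = a₀, D.N x x v = a₁, D.N x v v = a₂, D.N v v v = a₃, D.T x q = c at h h2 ⊢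
  -- Half of the seven-point difference formula for the derivative at 0, exact in degree at most 6.
  linear_combination (3 / 8 : ℂ) * (h 1 - h (-1)) - (3 / 40 : ℂ) * (h 2 - h (-2)) +
    (1 / 120 : ℂ) * (h 3 - h (-3)) - h2

/-- Linearizing `T_A_self` gives a sum of two terms. For `u = v` one of them is again an instance of
`T_A_self`, which isolates the other; then polarize. -/
theorem T_A (x u v : V) : D.T x (D.A u v) = 3 * D.N u v x := by
  have h1 : ∀ u v, D.T x (D.A u v) + D.T u (D.A x v) = 6 * D.N x u v := by
    intro u v
    have h := D.T_A_self (x + u) v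
    have hx := D.T_A_self x v
    have hu := D.T_A_self u v
    simp only [map_add, LinearMap.add_apply, D.N_comm u x] at h
    linear_combination h - hx - hu
  have h2 : ∀ v, D.T x (D.A v v) = 3 * D.N v v x := by
    intro v
    have h := h1 v v
    rw [D.A_comm x v, D.T_A_self, D.N_comm x v, D.N_right_comm v x] at h
    linear_combination h
  have h := h2 (u + v)
  simp only [map_add, LinearMap.add_apply, D.A_comm v u, D.N_comm v u] at h
  linear_combination (1 / 2 : ℂ) * (h - h2 u - h2 v)

end

/-- The conditions which normalize the pair at a base point `e`: the map `x ↦ A x x / N x x x` fixes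
`e` and has derivative `-1` there. -/
structure IsNormalizedAt (D : InverseQuadraticMaps V) (e : V) : Prop where
  A_e_e : D.A e e = e
  A_e : ∀ v, (2 : ℂ) • D.A e v = (3 * D.N e e v) • e - v
  N_e : D.N e e e = 1

namespace IsNormalizedAt

variable [FiniteDimensional ℂ V] {D : InverseQuadraticMaps V} {e : V} (h : D.IsNormalizedAt e)
include h

theorem T_e_e : D.T e e = 3 := by
  have := D.T_A_self e e
  rwa [h.A_e_e, h.N_e, mul_one] at this

theorem three_mul_N (v : V) : 3 * D.N e e v = D.T e v := by
  have h1 := congrArg (D.T e) (h.A_e v)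
  simp only [map_smul, map_sub, smul_eq_mul, D.T_A_self, h.T_e_e] at h1
  linear_combination -h1

theorem A_e' (v : V) : (2 : ℂ) • D.A e v = D.T e v • e - v := by
  rw [h.A_e, h.three_mul_N]

theorem B_e (v : V) : (2 : ℂ) • D.B e v = D.T e v • e - v := by
  have hee : D.B e e = e := by
    have := D.B_A e
    rwa [h.A_e_e, h.N_e, one_smul] at this
  have h1 := D.B_A_deriv e v
  have h2 := congrArg (D.B e) (h.A_e' v)
  rw [h.A_e_e, h.N_e, h.three_mul_N] at h1
  simp only [map_smul, map_sub, hee] at h2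
  linear_combination (norm := module) (2 : ℂ) • h2 - h1

/-- In the second-order expansion of `B(A x x) = N(x) x` at `e`, the term `8 B(A e s, A e s)`
contains `2 B s s`, since `2 A e s = T(e, s) e - s`. All other terms are expressed through `A s s`,
`T`, `e` and `s` by the normalization, so `B s s` can be solved for. -/
theorem B_self (s : V) : D.B s s = D.A s s := by
  have hee : D.B e e = e := by
    have := D.B_A e
    rwa [h.A_e_e, h.N_e, one_smul] at this
  have h1 := D.B_A_deriv₂ e s s
  have h2 := congrArg (fun x => D.B x x) (h.A_e' s)
  have h3 := h.B_e (D.A s s)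
  have h4 := h.B_e s
  simp only [map_smul, map_sub, LinearMap.smul_apply, LinearMap.sub_apply, hee,
    D.B_comm s e] at h2
  rw [h.A_e_e, h.three_mul_N, D.N_comm, D.N_right_comm] at h1
  have h5 := D.T_A e s s
  rw [h5] at h3
  linear_combination (norm := module) (-1 : ℂ) • h2 + (1 / 2 : ℂ) • h1 - h3 + D.T e s • h4

theorem B_eq (x y : V) : D.B x y = D.A x y := by
  have h1 := h.B_self (x + y)
  simp only [map_add, LinearMap.add_apply, D.A_comm y x, D.B_comm y x] at h1
  linear_combination (norm := module) (1 / 2 : ℂ) • (h1 - h.B_self x - h.B_self y)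

theorem M_self (x : V) : D.M x x x = D.N x x x := by
  by_cases hx : x = 0
  · simp [hx]
  have h1 := D.A_B x
  have h2 := D.B_A x
  simp only [h.B_eq] at h1 h2
  exact smul_left_injective ℂ hx (h1.symm.trans h2)

theorem M_eq (x v : V) : D.M x x v = D.N x x v := by
  have h1 := fun t : ℂ => h.M_self (x + t • v)
  have h2 := h.M_self v
  simp only [map_add, map_smul, LinearMap.add_apply, LinearMap.smul_apply, smul_eq_mul,
    D.N_comm v x, D.N_right_comm x v x, D.N_right_comm v v x,
    D.M_comm v x, D.M_right_comm x v x, D.M_right_comm v v x] at h1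
  linear_combination (1 / 6 : ℂ) * (h1 1 - h1 (-1)) - (1 / 3 : ℂ) * h2

/-- Both `N(x) T(x, y)` and `N(x) T(y, x)` equal `3 N(A x x, A x x, y)`: the first by `M_T` and `M =
N`, the second by `T_A` and `A(A x x) = N(x) x`. -/
theorem T_comm (x y : V) : D.T x y = D.T y x := by
  refine D.cancel (f := fun x => D.T x y) (g := fun x => D.T y x)
    (by fun_prop) (by fun_prop) (fun x => ?_) x
  have h1 := D.M_T x y
  have h2 := D.T_A y (D.A x x) (D.A x x)
  have h3 := D.B_A x
  rw [h.B_eq] at h3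
  rw [h3, map_smul] at h2
  rw [h.M_eq] at h1
  exact h1.symm.trans h2.symm

/-- This is `B_A_deriv` at the point `A x x`, with one factor `N(x)` cancelled. -/
theorem A_A_deriv (x y : V) :
    (4 : ℂ) • D.A x (D.A (D.A x x) y) = D.N x x x • y + D.T x y • D.A x x := by
  refine D.cancel (f := fun x => (4 : ℂ) • D.A x (D.A (D.A x x) y))
    (g := fun x => D.N x x x • y + D.T x y • D.A x x) ?_ ?_ (fun x => ?_) x
  · fun_prop
  · fun_prop
  have h1 := D.B_A_deriv (D.A x x) y
  have h2 := D.B_A x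
  have h3 := D.M_A x
  have h4 := D.M_T x y
  rw [h.B_eq] at h2
  rw [h.M_eq] at h3 h4
  rw [h.B_eq, h2, h3, h4, map_smul, LinearMap.smul_apply] at h1
  linear_combination (norm := module) h1

/-- The cubic norm structure of a normalized pair. -/
def cubicNorm : CubicNorm V where
  B := D.A
  T := D.T
  e := e
  B_comm := D.A_comm
  T_comm := h.T_comm
  T_B x y z := by rw [h.T_comm, D.T_A, h.T_comm, D.T_A, D.N_right_comm]
  B_B x := by
    have := D.B_A x
    rw [h.B_eq] at this
    rw [this, D.T_A, mul_div_cancel_left₀ _ three_ne_zero]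
  B_B_deriv x y := by
    have := D.B_A_deriv x y
    rw [h.B_eq] at this
    rw [this, h.T_comm _ y, D.T_A, D.T_A, mul_div_cancel_left₀ _ three_ne_zero]
  B_B_deriv' x y := by
    rw [h.A_A_deriv, D.T_A, mul_div_cancel_left₀ _ three_ne_zero]
  B_e := h.A_e'
  T_e_e := h.T_e_e

end IsNormalizedAt

/-- Composition with a linear automorphism: `A` is replaced by `K⁻¹ ∘ A`, and `B` by `B ∘ K`. -/
def twist (D : InverseQuadraticMaps V) (K : V ≃ₗ[ℂ] V) : InverseQuadraticMaps V where
  A := D.A.compr₂ K.symm.toLinearMap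
  B := D.B.compl₁₂ K.toLinearMap K.toLinearMap
  N := D.N
  M := LinearMap.mk₂ ℂ (fun x y => (D.M (K x) (K y)).comp K.toLinearMap)
    (fun x x' y => by ext; simp) (fun c x y => by ext; simp)
    (fun x y y' => by ext; simp) (fun c x y => by ext; simp)
  T := D.T.compl₂ K.toLinearMap
  A_comm x y := by simp [D.A_comm x y]
  B_comm x y := by simp [D.B_comm (K x)]
  N_comm := D.N_comm
  N_right_comm := D.N_right_comm
  M_comm x y z := by simp [D.M_comm (K x)]
  M_right_comm x y z := by simp [D.M_right_comm (K x) (K y)]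
  B_A x := by simp [D.B_A]
  A_B x := by simp [D.A_B]
  M_A x := by simp [D.M_A]
  M_T x w := by simp [D.M_T]
  dense := D.dense

variable (D : InverseQuadraticMaps V)

/-- Minus the derivative at `e` of `x ↦ A x x / N x x x`, where `N e e e = 1`. -/
def negDeriv (e : V) : V →ₗ[ℂ] V :=
  (3 : ℂ) • (D.N e e).smulRight (D.A e e) - (2 : ℂ) • D.A e

theorem negDeriv_apply (e v : V) :
    D.negDeriv e v = (3 * D.N e e v) • D.A e e - (2 : ℂ) • D.A e v := by
  simp [negDeriv, mul_smul]

theorem negDeriv_self {e : V} (he : D.N e e e = 1) : D.negDeriv e e = D.A e e := by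
  rw [negDeriv_apply, he]
  module

/-- Applying `B (A e e)` to `negDeriv e v = 0` and comparing with `B_A_deriv` shows that `v` is a
multiple of `e`; but `negDeriv e e = A e e` is nonzero. -/
theorem negDeriv_injective {e : V} (he : D.N e e e = 1) :
    Function.Injective (D.negDeriv e) := by
  rw [injective_iff_map_eq_zero]
  intro v hv
  have h0 := D.B_A e
  have h1 := D.B_A_deriv e v
  have h2 := congrArg (D.B (D.A e e)) ((D.negDeriv_apply e v).symm.trans hv)
  rw [he] at h0 h1
  simp only [map_sub, map_smul, map_zero, h0] at h2
  have h3 : v = (3 * D.N e e v) • e := by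
    linear_combination (norm := module) (-2 : ℂ) • h2 - h1
  have h4 : D.A e e ≠ 0 := by
    intro h
    rw [h, map_zero] at h0
    have : e = 0 := by simpa using h0.symm
    simp [this] at he
  rw [h3, map_smul, D.negDeriv_self he, smul_eq_zero] at hv
  rw [h3, hv.resolve_right h4, zero_smul]

variable [FiniteDimensional ℂ V]

/-- Minus the derivative at `e` of `x ↦ A x x / N x x x`, as a linear automorphism. -/
noncomputable def negDerivEquiv {e : V} (he : D.N e e e = 1) : V ≃ₗ[ℂ] V :=
  LinearEquiv.ofInjectiveEndo (D.negDeriv e) (D.negDeriv_injective he)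

theorem twist_isNormalizedAt {e : V} (he : D.N e e e = 1) :
    (D.twist (D.negDerivEquiv he)).IsNormalizedAt e where
  A_e_e := by
    change (D.negDerivEquiv he).symm (D.A e e) = e
    rw [LinearEquiv.symm_apply_eq]
    exact (D.negDeriv_self he).symm
  A_e v := by
    change (2 : ℂ) • (D.negDerivEquiv he).symm (D.A e v) = (3 * D.N e e v) • e - v
    rw [← map_smul, LinearEquiv.symm_apply_eq, map_sub, map_smul]
    change _ = _ • D.negDeriv e e - D.negDeriv e v
    rw [D.negDeriv_self he, negDeriv_apply]
    module
  N_e := he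

end InverseQuadraticMaps

end Multilinear

/-! ### The Jordan algebra of a cubic norm -/

namespace CubicNorm

section

variable {V : Type} [AddCommGroup V] [Module ℂ V] (C : CubicNorm V)

theorem B_e_left (x : V) : C.B C.e x = (1 / 2 : ℂ) • (C.T C.e x • C.e - x) := by
  rw [← C.B_e]
  module

theorem B_e_right (x : V) : C.B x C.e = (1 / 2 : ℂ) • (C.T C.e x • C.e - x) := by
  rw [C.B_comm, B_e_left]

/-- This identifies the last coefficient in `mul` as `T(e, B x y)`, so that `mul` polarizes `x² =
x^# + T(x) x - S(x) e`. -/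
theorem T_e_B (x y : V) :
    C.T C.e (C.B x y) = (1 / 2 : ℂ) * (C.T C.e x * C.T C.e y - C.T x y) := by
  rw [C.T_comm, C.T_B, B_e_right]
  simp

theorem B_self_B (x : V) : C.B x (C.B x x) = (1 / 2 : ℂ) •
    ((C.T C.e x * C.T C.e (C.B x x) - C.T x (C.B x x) / 3) • C.e
      - C.T C.e x • C.B x x - C.T C.e (C.B x x) • x) := by
  have h := C.B_B_deriv' x C.e
  rw [B_e_right, map_smul, map_sub, map_smul, B_e_right, C.T_comm x C.e] at h
  linear_combination (norm := module) (-1 / 2 : ℂ) • h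

theorem T_B_B (x y : V) : C.T (C.B x x) (C.B x y) = C.T x (C.B (C.B x x) y) := by
  rw [C.T_comm _ (C.B x y), C.T_B, C.T_comm x, C.T_B (C.B x x), C.B_comm x]

/-- The product of the algebra of a cubic norm. -/
noncomputable def mul (x y : V) : V :=
  C.B x y + (1 / 2 : ℂ) • (C.T C.e x • y + C.T C.e y • x - (C.T C.e x * C.T C.e y - C.T x y) • C.e)

theorem mul_comm' (x y : V) : C.mul x y = C.mul y x := by
  rw [mul, mul, C.B_comm, C.T_comm x y]
  module

theorem mul_add' (x y z : V) : C.mul x (y + z) = C.mul x y + C.mul x z := by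
  simp only [mul, map_add]
  module

theorem mul_smul' (c : ℂ) (x y : V) : C.mul x (c • y) = c • C.mul x y := by
  simp only [mul, map_smul, smul_eq_mul]
  module

theorem add_mul' (x y z : V) : C.mul (x + y) z = C.mul x z + C.mul y z := by
  rw [C.mul_comm', mul_add', C.mul_comm' z, C.mul_comm' z]

theorem smul_mul' (c : ℂ) (x y : V) : C.mul (c • x) y = c • C.mul x y := by
  rw [C.mul_comm', mul_smul', C.mul_comm' y]

theorem zero_mul' (x : V) : C.mul 0 x = 0 := by simpa using C.smul_mul' 0 0 x

theorem mul_zero' (x : V) : C.mul x 0 = 0 := by simpa using C.mul_smul' 0 x 0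

theorem mul_e (x : V) : C.mul x C.e = x := by
  rw [mul, B_e_right, C.T_e_e, C.T_comm x]
  module

theorem mul_self (x : V) :
    C.mul x x = C.B x x + C.T C.e x • x - C.T C.e (C.B x x) • C.e := by
  rw [mul, T_e_B]
  module

theorem mul_B_self (x : V) : C.mul x (C.B x x) = (C.T x (C.B x x) / 3) • C.e := by
  rw [mul, B_self_B]
  module

theorem mul_self_B (x : V) :
    C.mul (C.B x x) (C.B x x) = (C.T x (C.B x x) / 3) • x + C.T C.e (C.B x x) • C.B x x -
      C.T C.e (C.B (C.B x x) (C.B x x)) • C.e := by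
  rw [mul_self, C.B_B]

/-- After expansion both sides differ by a multiple of `B_B_deriv - B_B_deriv'`, whose right-hand
sides involve only `T`, `x`, `y` and `x^#`. -/
theorem mul_mul_B_self (x y : V) :
    C.mul (C.mul x y) (C.B x x) = C.mul x (C.mul y (C.B x x)) := by
  have h1 := C.B_B_deriv x y
  have h2 := C.B_B_deriv' x y
  have h3 := C.T_B_B x y
  rw [C.mul_comm' _ (C.B x x), C.mul_comm' y]
  simp only [mul, map_add, map_sub, map_smul, smul_eq_mul, B_e_right, T_e_B, C.T_e_e,
    C.T_comm x C.e, C.T_comm (C.B x x) C.e, C.B_comm (C.B x x) x, C.T_comm (C.B x x) x, ← h3]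
  linear_combination (norm := module) (1 / 4 : ℂ) • (h1 - h2)

/-- Since `x²` is a combination of `x^#`, `x` and `e`, only the `x^#` part needs an argument beyond
commutativity. -/
theorem jordan (x y : V) : C.mul (C.mul x y) (C.mul x x) = C.mul x (C.mul y (C.mul x x)) := by
  rw [mul_self, sub_eq_add_neg, ← neg_smul]
  simp only [mul_add', mul_smul', mul_e, mul_mul_B_self]
  rw [C.mul_comm' _ x, C.mul_comm' y x]

theorem cubic_equation (x : V) :
    C.mul x (C.mul x x) - C.T C.e x • C.mul x x + C.T C.e (C.B x x) • x -
      (C.T x (C.B x x) / 3) • C.e = 0 := by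
  have h := C.mul_self x
  rw [sub_eq_add_neg, ← neg_smul] at h
  rw [h]
  simp only [mul_add', mul_smul', mul_e, mul_B_self, h]
  module

/-- The polarized norm form. -/
noncomputable def normMultilinear : MultilinearMap ℂ (fun _ : Fin 3 => V) ℂ where
  toFun m := C.T (m 0) (C.B (m 1) (m 2)) / 3
  map_update_add' := by
    intro inst m i x y
    cases Subsingleton.elim inst (instDecidableEqFin 3)
    fin_cases i <;> simp [add_div]
  map_update_smul' := by
    intro inst m i c x
    cases Subsingleton.elim inst (instDecidableEqFin 3)
    fin_cases i <;> simp [mul_div_assoc]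

/-- The vector space `V` with the Jordan product of a cubic norm. -/
def Algebra (_ : CubicNorm V) : Type := V

instance : AddCommGroup C.Algebra := inferInstanceAs (AddCommGroup V)

noncomputable instance : NonAssocCommRing C.Algebra where
  mul := C.mul
  one := C.e
  left_distrib := C.mul_add'
  right_distrib := C.add_mul'
  zero_mul := C.zero_mul'
  mul_zero := C.mul_zero'
  one_mul x := (C.mul_comm' _ _).trans (C.mul_e x)
  mul_one := C.mul_e
  mul_comm := C.mul_comm'

noncomputable instance : Module ℂ C.Algebra := inferInstanceAs (Module ℂ V)

instance : SMulCommClass ℂ C.Algebra C.Algebra where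
  smul_comm c x y := (C.mul_smul' c x y).symm

instance : IsScalarTower ℂ C.Algebra C.Algebra where
  smul_assoc := C.smul_mul'

instance : IsCommJordan C.Algebra where
  lmul_comm_rmul_rmul := C.jordan

/-- The generic trace, quadratic form and norm of the algebra of a cubic norm. -/
noncomputable def genericCubic : GenericCubic C.Algebra where
  T := C.T C.e
  S := LinearMap.BilinMap.toQuadraticMap (M := V) (C.B.compr₂ (C.T C.e))
  N x := C.T x (C.B x x) / 3
  cubic := ⟨C.normMultilinear, fun _ => rfl⟩
  equation := C.cubic_equation

theorem genericCubic_adjoint (x : V) : C.genericCubic.adjoint x = C.B x x := by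
  change C.mul x x - C.T C.e x • x + C.T C.e (C.B x x) • C.e = C.B x x
  rw [C.mul_self]
  module

end

end CubicNorm

/-! ### The rank of the algebra -/

section Rank

theorem HoldsGenerally.mono {J : Type} [AddCommGroup J] [Module ℂ J] {P Q : J → Prop}
    (h : HoldsGenerally P) (hPQ : ∀ x, P x → Q x) : HoldsGenerally Q := by
  obtain ⟨p, hp, hP⟩ := h
  exact ⟨p, hp, fun x hx => hPQ x (hP x hx)⟩

/-- A quadratic form vanishing on the kernel of a linear form is divisible by it. -/
theorem LinearMap.apply_self_eq_mul {V : Type*} [AddCommGroup V] [Module ℂ V]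
    {Q : V →ₗ[ℂ] V →ₗ[ℂ] ℂ} {y : V →ₗ[ℂ] ℂ} {u : V} (hu : y u = 1)
    (h : ∀ x, y x = 0 → Q x x = 0) (x : V) :
    Q x x = y x * (Q.flip u + Q u - Q u u • y) x := by
  have := h (x - y x • u) (by simp [hu])
  simp only [map_sub, map_smul, LinearMap.sub_apply, LinearMap.smul_apply, smul_eq_mul] at this
  simp
  linear_combination this

/-- If `e`, `x`, `Q x x` are independent for one `x`, then they are so for general `x`. -/
theorem holdsGenerally_linearIndependent {V : Type} [AddCommGroup V] [Module ℂ V]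
    [FiniteDimensional ℂ V] (Q : V →ₗ[ℂ] V →ₗ[ℂ] V) (e : V) {x₀ : V}
    (h : LinearIndependent ℂ ![e, x₀, Q x₀ x₀]) :
    HoldsGenerally fun x : V => LinearIndependent ℂ ![e, x, Q x x] := by
  obtain ⟨g, hg⟩ := LinearMap.exists_leftInverse_of_injective
    (Fintype.linearCombination ℂ ![e, x₀, Q x₀ x₀])
    (LinearMap.ker_eq_bot.2 (linearIndependent_iff_injective_fintypeLinearCombination.1 h))
  have hg' : ∀ i j, g (![e, x₀, Q x₀ x₀] i) j = (1 : Matrix (Fin 3) (Fin 3) ℂ) i j := by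
    intro i j
    have h1 := congrFun (congrArg DFunLike.coe hg) (Pi.single i 1)
    simp only [LinearMap.comp_apply, Fintype.linearCombination_apply_single, one_smul] at h1
    rw [h1, LinearMap.id_apply, Matrix.one_apply, Pi.single_apply]
    simp [eq_comm]
  let b := Module.finBasis ℂ V
  let f : Fin 3 → Module.Dual ℂ V := fun j => (LinearMap.proj j).comp g
  let q : Fin 3 → MvPolynomial (Module.Dual ℂ V) ℂ := fun j =>
    ∑ k, ∑ l, MvPolynomial.C (f j (Q (b k) (b l))) *
      (MvPolynomial.X (b.coord k) * MvPolynomial.X (b.coord l))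
  have hq : ∀ x j, MvPolynomial.eval (fun φ : Module.Dual ℂ V => φ x) (q j) = g (Q x x) j := by
    intro x j
    have hx : Q x x = ∑ k, ∑ l, (b.coord k x * b.coord l x) • Q (b k) (b l) := by
      conv_lhs => rw [← b.sum_repr x]
      simp only [map_sum, map_smul, LinearMap.sum_apply, LinearMap.smul_apply, Finset.smul_sum,
        smul_smul, Module.Basis.coord_apply]
      rw [Finset.sum_comm]
      simp only [mul_comm]
    change _ = f j (Q x x)
    rw [hx]
    simp only [q, map_sum, map_mul, map_smul, MvPolynomial.eval_X, MvPolynomial.eval_C,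
      smul_eq_mul, mul_comm]
  -- The rows are the images of `e`, `x`, `Q x x` under `g`. The determinant is a polynomial
  -- function of `x` with value 1 at `x₀`, and independence holds wherever it is nonzero.
  let P : Matrix (Fin 3) (Fin 3) (MvPolynomial (Module.Dual ℂ V) ℂ) := Matrix.of
    ![fun j => MvPolynomial.C (f j e), fun j => MvPolynomial.X (f j), q]
  have hP : ∀ x, MvPolynomial.eval (fun φ : Module.Dual ℂ V => φ x) P.det =
      Matrix.det (Matrix.of fun i => g (![e, x, Q x x] i)) := by
    intro x
    rw [RingHom.map_det]
    congr 1
    ext i j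
    fin_cases i
    · exact MvPolynomial.eval_C _
    · exact MvPolynomial.eval_X _
    · exact hq x j
  refine ⟨P.det, ⟨x₀, ?_⟩, fun x hx => ?_⟩
  · rw [hP, show (Matrix.of fun i => g (![e, x₀, Q x₀ x₀] i)) = 1 from Matrix.ext hg',
      Matrix.det_one]
    exact one_ne_zero
  · rw [hP] at hx
    exact LinearIndependent.of_comp g (Matrix.linearIndependent_rows_of_det_ne_zero hx)

namespace CubicNorm

variable {V : Type} [AddCommGroup V] [Module ℂ V] (C : CubicNorm V)

theorem e_ne_zero : C.e ≠ 0 := by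
  intro h
  have := C.T_e_e
  simp [h] at this

theorem B_e_e : C.B C.e C.e = C.e := by
  rw [B_e_left, C.T_e_e]
  module

/-- If `e`, `x`, `B x x` are dependent for all `x`, then the adjoint is a linear form times a
linear map. -/
theorem exists_factor_of_dependent [FiniteDimensional ℂ V] (hV : 2 ≤ Module.finrank ℂ V)
    (h : ∀ x, ¬ LinearIndependent ℂ ![C.e, x, C.B x x]) :
    ∃ (α : V →ₗ[ℂ] ℂ) (L : V →ₗ[ℂ] V), ∀ x, C.B x x = α x • L x := by
  have hspan : ∀ x, ∃ a b : ℂ, C.B x x = a • x + b • C.e := by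
    intro x
    obtain ⟨g, hg, i, hi⟩ := Fintype.not_linearIndependent_iff.1 (h x)
    simp only [Fin.sum_univ_three, Matrix.cons_val] at hg
    by_cases h2 : g 2 = 0
    · by_cases h1 : g 1 = 0
      · rw [h1, h2, zero_smul, zero_smul, add_zero, add_zero, smul_eq_zero] at hg
        have h0 := hg.resolve_right C.e_ne_zero
        fin_cases i <;> simp_all
      · have hx : x = (-(g 0 / g 1)) • C.e := by
          apply smul_right_injective V h1
          simp only [smul_smul]
          rw [show g 1 * -(g 0 / g 1) = - g 0 by field_simp]
          rw [h2] at hg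
          linear_combination (norm := module) hg
        refine ⟨0, (g 0 / g 1) ^ 2, ?_⟩
        rw [hx]
        simp only [map_smul, LinearMap.smul_apply, B_e_e]
        module
    · refine ⟨-(g 1 / g 2), -(g 0 / g 2), ?_⟩
      apply smul_right_injective V h2
      simp only [smul_add, smul_smul]
      rw [show g 2 * -(g 0 / g 2) = - g 0 by field_simp,
        show g 2 * -(g 1 / g 2) = - g 1 by field_simp]
      linear_combination (norm := module) hg
  obtain ⟨y, hy0, hy⟩ : ∃ y : V →ₗ[ℂ] ℂ, y ≠ 0 ∧ y C.e = 0 := by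
    have hlt : Submodule.span ℂ {C.e} < ⊤ := by
      apply lt_of_le_of_ne le_top
      intro h
      have h1 := finrank_span_singleton (K := ℂ) C.e_ne_zero
      rw [h, finrank_top] at h1
      omega
    obtain ⟨y, hy0, hy⟩ := Submodule.exists_le_ker_of_lt_top _ hlt
    exact ⟨y, hy0, hy (Submodule.mem_span_singleton_self _)⟩
  obtain ⟨u, hu⟩ : ∃ u, y u = 1 := by
    obtain ⟨v, hv⟩ := DFunLike.ne_iff.1 hy0
    exact ⟨(y v)⁻¹ • v, by simpa using inv_mul_cancel₀ hv⟩
  -- As `B x x` lies in the span of `x` and `e`, and `y e = 0`, the form `y (B x x)` vanishes where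
  -- `y` does. The quotient `α` is the coefficient of `x` in `B x x` when `y x ≠ 0`; `β` below
  -- recovers the coefficient of `e` by the trace, using `T e e = 3`.
  let α := (C.B.compr₂ y).flip u + C.B.compr₂ y u - C.B.compr₂ y u u • y
  have hα : ∀ x, y (C.B x x) = y x * α x := by
    refine LinearMap.apply_self_eq_mul (Q := C.B.compr₂ y) hu fun x hx => ?_
    obtain ⟨a, b, hab⟩ := hspan x
    simp [hab, hx, hy]
  let R : V →ₗ[ℂ] V →ₗ[ℂ] V := C.B - α.smulRight LinearMap.id
  let β : V →ₗ[ℂ] V →ₗ[ℂ] ℂ := R.compr₂ ((1 / 3 : ℂ) • C.T C.e)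
  let E : V →ₗ[ℂ] V →ₗ[ℂ] V := R - β.compr₂ (LinearMap.toSpanSingleton ℂ V C.e)
  have hE : ∀ x, E x x = C.B x x - α x • x - β x x • C.e := by
    intro x
    simp [E, R]
  have hβ : ∀ x, β x x = (1 / 3 : ℂ) * (C.T C.e (C.B x x) - α x * C.T C.e x) := by
    intro x
    simp [β, R]
  have hE1 : ∀ x, y x ≠ 0 → E x x = 0 := by
    intro x hx
    obtain ⟨a, b, hab⟩ := hspan x
    have h1 := hα x
    rw [hab] at h1
    simp only [map_add, map_smul, smul_eq_mul, hy, mul_zero, add_zero] at h1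
    have h2 : a = α x := by
      apply mul_right_cancel₀ hx
      rw [h1, mul_comm]
    rw [hE, hβ, hab, ← h2]
    simp only [map_add, map_smul, smul_eq_mul, C.T_e_e]
    module
  -- On the hyperplane `y = 0`, use the parallelogram identity with `x + u`, `x - u` and `u`, which
  -- all lie off it.
  have hE0 : ∀ x, E x x = 0 := by
    intro x
    by_cases hx : y x = 0
    · have h1 := hE1 (x + u) (by simp [hx, hu])
      have h2 := hE1 (x - u) (by simp [hx, hu])
      have h3 := hE1 u (by simp [hu])
      simp only [map_add, map_sub, LinearMap.add_apply, LinearMap.sub_apply, h3] at h1 h2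
      linear_combination (norm := module) (1 / 2 : ℂ) • (h1 + h2)
    · exact hE1 x hx
  have hB : ∀ x, C.B x x = α x • x + β x x • C.e := by
    intro x
    have := hE x
    rw [hE0] at this
    linear_combination (norm := module) -this
  have hαe : α C.e = -1 := by
    have h1 := hα (C.e + u)
    simp only [map_add, LinearMap.add_apply, B_e_left, B_e_right, hα u, C.T_e_e, map_smul, map_sub,
      smul_eq_mul, hy, hu] at h1
    linear_combination -h1
  -- If `α x = 0` then `B x x = β e`, so `x^## = N(x) x` reads `β² e = N(x) x`; applying `α` gives
  -- `β² = 0`. Hence `α` divides `β`, and so divides all of `B x x = α(x) x + β e`.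
  have hβα : ∀ x, α x = 0 → β x x = 0 := by
    intro x hx
    have h1 := C.B_B x
    rw [hB x, hx, zero_smul, zero_add] at h1
    simp only [map_smul, LinearMap.smul_apply, B_e_e, smul_smul] at h1
    have h2 := congrArg α h1
    simp only [map_smul, hαe, hx, smul_eq_mul, mul_zero] at h2
    simpa using h2
  have hγ := LinearMap.apply_self_eq_mul (Q := β) (y := α) (u := -C.e) (by simp [hαe]) hβα
  refine ⟨α, LinearMap.id +
    (β.flip (-C.e) + β (-C.e) - β (-C.e) (-C.e) • α).smulRight C.e, fun x => ?_⟩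
  rw [hB, hγ x]
  simp only [LinearMap.add_apply, LinearMap.id_apply, LinearMap.smulRight_apply, smul_add,
    smul_smul]

/-- The subalgebra generated by `1` and `x` is spanned by `1`, `x` and the adjoint of `x`. -/
theorem toSubmodule_adjoin (x : C.Algebra) :
    (NonUnitalAlgebra.adjoin ℂ ({1, x} : Set C.Algebra)).toSubmodule =
      Submodule.span ℂ (Set.range ![(1 : C.Algebra), x, (C.B x x : V)]) := by
  have hX : (C.B x x : V) = x * x - C.T C.e x • x + C.T C.e (C.B x x) • (1 : C.Algebra) :=
    (C.genericCubic_adjoint x).symm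
  set X : C.Algebra := (C.B x x : V) with hXdef
  set S := Submodule.span ℂ (Set.range ![(1 : C.Algebra), x, X]) with hS
  have h1 : (1 : C.Algebra) ∈ S := Submodule.subset_span ⟨0, rfl⟩
  have hx : x ∈ S := Submodule.subset_span ⟨1, rfl⟩
  have hX' : X ∈ S := Submodule.subset_span ⟨2, rfl⟩
  have hxx : x * x ∈ S := by
    have : x * x = X + C.T C.e x • x - C.T C.e (C.B x x) • (1 : C.Algebra) := C.mul_self x
    rw [this]
    exact S.sub_mem (S.add_mem hX' (S.smul_mem _ hx)) (S.smul_mem _ h1)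
  have hxX : x * X ∈ S := by
    have : x * X = (C.T x (C.B x x) / 3) • (1 : C.Algebra) := C.mul_B_self x
    rw [this]
    exact S.smul_mem _ h1
  have hXX : X * X ∈ S := by
    have : X * X = (C.T x (C.B x x) / 3) • x + C.T C.e (C.B x x) • X -
        C.T C.e (C.B (C.B x x) (C.B x x)) • (1 : C.Algebra) := C.mul_self_B x
    rw [this]
    exact S.sub_mem (S.add_mem (S.smul_mem _ hx) (S.smul_mem _ hX')) (S.smul_mem _ h1)
  have hmul : ∀ {a b}, a ∈ S → b ∈ S → a * b ∈ S := by
    intro a b ha hb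
    induction ha, hb using Submodule.span_induction₂ with
    | mem_mem a b ha hb =>
      obtain ⟨i, rfl⟩ := ha
      obtain ⟨j, rfl⟩ := hb
      fin_cases i <;> fin_cases j <;> simp [h1, hx, hX', hxx, hxX, hXX, mul_comm X x]
    | zero_left b hb => simp
    | zero_right a ha => simp
    | add_left a b c ha hb hc h h' => rw [add_mul]; exact S.add_mem h h'
    | add_right a b c ha hb hc h h' => rw [mul_add]; exact S.add_mem h h'
    | smul_left r a b ha hb h => rw [smul_mul_assoc]; exact S.smul_mem _ h
    | smul_right r a b ha hb h => rw [mul_smul_comm]; exact S.smul_mem _ h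
  apply le_antisymm
  · let A : NonUnitalSubalgebra ℂ C.Algebra :=
      { S with
        mul_mem' := hmul }
    have : NonUnitalAlgebra.adjoin ℂ ({1, x} : Set C.Algebra) ≤ A := by
      apply NonUnitalAlgebra.adjoin_le
      rintro a (rfl | rfl)
      · exact h1
      · exact hx
    exact this
  · rw [hS, Submodule.span_le]
    set A := NonUnitalAlgebra.adjoin ℂ ({1, x} : Set C.Algebra)
    have h1 : (1 : C.Algebra) ∈ A := NonUnitalAlgebra.subset_adjoin ℂ (by simp)
    have hx : x ∈ A := NonUnitalAlgebra.subset_adjoin ℂ (by simp)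
    have hX'' : X ∈ A := by
      rw [hX]
      exact add_mem (sub_mem (mul_mem hx hx) (A.smul_mem _ hx)) (A.smul_mem _ h1)
    rintro _ ⟨i, rfl⟩
    fin_cases i
    · exact h1
    · exact hx
    · exact hX''

theorem hasRank_three [FiniteDimensional ℂ V] {x₀ : V}
    (h : LinearIndependent ℂ ![C.e, x₀, C.B x₀ x₀]) : HasRank C.Algebra 3 := by
  have h1 : HoldsGenerally (J := C.Algebra) fun x =>
      LinearIndependent ℂ ![(1 : C.Algebra), x, (C.B x x : V)] :=
    holdsGenerally_linearIndependent C.B C.e h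
  refine h1.mono fun x hx => ?_
  have h2 := finrank_span_eq_card hx
  rw [← toSubmodule_adjoin, Fintype.card_fin] at h2
  exact h2

end CubicNorm

end Rank

/-! ### Passage between polynomials and multilinear maps -/

section Cremona

variable {n : ℕ}

theorem MvPolynomial.eval_bind₁ {σ τ : Type*} (x : τ → ℂ) (F : σ → MvPolynomial τ ℂ)
    (p : MvPolynomial σ ℂ) : eval x (bind₁ F p) = eval (fun i => eval x (F i)) p := by
  induction p using MvPolynomial.induction_on with
  | C a => simp
  | add p q hp hq => simp [hp, hq]
  | mul_X p i hp => simp [hp]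

/-- On the line from `x` to a point where `p` does not vanish, `p` is a nonzero polynomial in one
variable. It has finitely many roots, so `x` is a limit of points where `p` does not vanish. -/
theorem MvPolynomial.dense_eval_ne_zero {p : MvPolynomial (Fin n) ℂ} (hp : p ≠ 0) :
    Dense {x : Fin n → ℂ | eval x p ≠ 0} := by
  obtain ⟨a, ha⟩ : ∃ a, eval a p ≠ 0 := by
    by_contra! h
    exact hp (MvPolynomial.funext fun x => by simp [h x])
  intro x
  let Q : Polynomial ℂ :=
    aeval (fun i => Polynomial.C (x i) + Polynomial.X * Polynomial.C (a i - x i)) p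
  have hQ : ∀ t, Q.eval t = eval (fun i => x i + t * (a i - x i)) p := by
    intro t
    have := MvPolynomial.map_aeval
      (fun i => Polynomial.C (x i) + Polynomial.X * Polynomial.C (a i - x i))
      (Polynomial.evalRingHom t) p
    have hid : (Polynomial.evalRingHom t).comp (algebraMap ℂ (Polynomial ℂ)) = RingHom.id ℂ := by
      ext
      simp
    rw [hid] at this
    refine this.trans ?_
    change eval _ p = _
    simp
  have hQ0 : Q ≠ 0 := by
    intro h
    have := hQ 1
    simp [h] at this
    exact ha this.symm
  have : Finite {t | Q.IsRoot t} := Polynomial.finite_setOfPred_isRoot hQ0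
  have hd : Dense ({t | Q.IsRoot t}ᶜ : Set ℂ) :=
    (Set.toFinite _).countable.dense_compl ℂ
  have hc : Continuous fun t : ℂ => fun i => x i + t * (a i - x i) := by fun_prop
  have := hc.continuousWithinAt.mem_closure_image (hd 0)
  simp only [zero_mul, add_zero] at this
  refine closure_mono ?_ this
  rintro _ ⟨t, ht, rfl⟩
  simpa [← hQ] using ht

/-- The polynomial of a linear form. -/
noncomputable def LinearMap.toMvPolynomialForm (l : (Fin n → ℂ) →ₗ[ℂ] ℂ) :
    MvPolynomial (Fin n) ℂ := ∑ i, C (l (Pi.single i 1)) * X i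

theorem LinearMap.eval_toMvPolynomialForm (l : (Fin n → ℂ) →ₗ[ℂ] ℂ) (x : Fin n → ℂ) :
    eval x l.toMvPolynomialForm = l x := by
  have h : ∀ i : Fin n, (Pi.single i 1 : Fin n → ℂ) = fun j => if i = j then 1 else 0 := by
    intro i
    ext j
    simp [Pi.single_apply, eq_comm]
  rw [LinearMap.pi_apply_eq_sum_univ l x]
  simp [toMvPolynomialForm, mul_comm, h]

theorem QuadraticInversePair.exists_inverseQuadraticMaps {F G : Fin n → MvPolynomial (Fin n) ℂ}
    {N M : MvPolynomial (Fin n) ℂ} (h : QuadraticInversePair F G N M) (hF0 : ∃ i, F i ≠ 0) :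
    ∃ D : InverseQuadraticMaps (Fin n → ℂ), ∀ x i, D.A x x i = eval x (F i) := by
  choose a a_comm ha using fun i => (h.homF i).exists_bilinearMap
  choose b b_comm hb using fun i => (h.homG i).exists_bilinearMap
  obtain ⟨N', hN1, hN2, hN3, -⟩ := h.homN.exists_trilinearMap
  obtain ⟨M', hM1, hM2, hM3, hM4⟩ := h.homM.exists_trilinearMap
  choose t ht1 ht2 using h.exists_trace hF0
  choose t' ht' using fun i => (ht1 i).exists_linearMap
  have ha' : ∀ x, (fun i => a i x x) = fun i => eval x (F i) := fun x => funext fun i => ha i x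
  have hb' : ∀ x, (fun i => b i x x) = fun i => eval x (G i) := fun x => funext fun i => hb i x
  refine ⟨{
    A := LinearMap.mk₂ ℂ (fun x y i => a i x y) (fun _ _ _ => by ext; simp)
      (fun _ _ _ => by ext; simp) (fun _ _ _ => by ext; simp) (fun _ _ _ => by ext; simp)
    B := LinearMap.mk₂ ℂ (fun x y i => b i x y) (fun _ _ _ => by ext; simp)
      (fun _ _ _ => by ext; simp) (fun _ _ _ => by ext; simp) (fun _ _ _ => by ext; simp)
    N := N'
    M := M'
    T := ∑ k, (t' k).smulRight (LinearMap.proj k)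
    A_comm := fun x y => funext fun i => a_comm i x y
    B_comm := fun x y => funext fun i => b_comm i x y
    N_comm := hN1
    N_right_comm := hN2
    M_comm := hM1
    M_right_comm := hM2
    B_A := fun x => funext fun i => ?_
    A_B := fun x => funext fun i => ?_
    M_A := fun x => ?_
    M_T := fun x w => ?_
    dense := ?_ }, fun x i => ha i x⟩
  · have := congrArg (eval x) (h.comp_left i)
    simp only [LinearMap.mk₂_apply, ha', hb, Pi.smul_apply, smul_eq_mul, hN3]
    simpa [eval_bind₁] using this
  · have := congrArg (eval x) (h.comp_right i)
    simp only [LinearMap.mk₂_apply, hb', ha, Pi.smul_apply, smul_eq_mul, hM3]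
    simpa [eval_bind₁] using this
  · have := congrArg (eval x) (h.bind₁_norm hF0)
    simp only [LinearMap.mk₂_apply, ha', hM3, hN3]
    simpa [eval_bind₁] using this
  · have hk := fun k => congrArg (eval x) (ht2 k)
    simp only [eval_bind₁, map_mul] at hk
    simp only [LinearMap.mk₂_apply, ha', hM4, hk, hN3, LinearMap.sum_apply, Finset.mul_sum,
      LinearMap.smulRight_apply, LinearMap.smul_apply, LinearMap.proj_apply, ht', smul_eq_mul]
    exact Finset.sum_congr rfl fun k _ => by ring
  · simp only [hN3]
    exact dense_eval_ne_zero h.ne_zero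

theorem InverseQuadraticMaps.exists_base_point {V : Type*} [NormedAddCommGroup V]
    [NormedSpace ℂ V] (D : InverseQuadraticMaps V) : ∃ e, D.N e e e = 1 := by
  obtain ⟨x, hx⟩ := D.dense.nonempty
  -- Scaling by a cube root normalizes the cubic form to 1.
  obtain ⟨c, hc⟩ := IsAlgClosed.exists_pow_nat_eq (D.N x x x)⁻¹ (n := 3) (by norm_num)
  refine ⟨c • x, ?_⟩
  simp only [map_smul, LinearMap.smul_apply, smul_eq_mul]
  rw [← mul_inv_cancel₀ hx, ← hc]
  ring

/-- Every quadro-quadric Cremona transformation is, up to a linear automorphism of the target, the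
adjoint of a cubic norm. -/
theorem QuadraticInversePair.exists_cubicNorm {F G : Fin n → MvPolynomial (Fin n) ℂ}
    {N M : MvPolynomial (Fin n) ℂ} (h : QuadraticInversePair F G N M) (hF0 : ∃ i, F i ≠ 0) :
    ∃ (C : CubicNorm (Fin n → ℂ)) (K : (Fin n → ℂ) ≃ₗ[ℂ] (Fin n → ℂ)),
      ∀ x i, K (C.B x x) i = eval x (F i) := by
  obtain ⟨D, hD⟩ := h.exists_inverseQuadraticMaps hF0
  obtain ⟨e, he⟩ := D.exists_base_point
  refine ⟨(D.twist_isNormalizedAt he).cubicNorm, D.negDerivEquiv he, fun x i => ?_⟩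
  rw [← hD]
  change D.negDerivEquiv he ((D.negDerivEquiv he).symm (D.A x x)) i = _
  rw [LinearEquiv.apply_symm_apply]

theorem MvPolynomial.eval_sum_toMatrix (K : (Fin n → ℂ) →ₗ[ℂ] (Fin n → ℂ))
    (F : Fin n → MvPolynomial (Fin n) ℂ) (x : Fin n → ℂ) (i : Fin n) :
    eval x (∑ j, C (LinearMap.toMatrix' K i j) * F j) = K (fun j => eval x (F j)) i := by
  conv_rhs => rw [← LinearMap.toMatrix'_mulVec]
  simp [Matrix.mulVec, dotProduct]

/-- The rational map of the adjoint of a cubic norm. -/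
theorem CubicNorm.exists_homTuple (C : CubicNorm (Fin n → ℂ)) (F : Fin n → MvPolynomial (Fin n) ℂ)
    (hF : ∀ i, (F i).IsHomogeneous 2) (K : (Fin n → ℂ) ≃ₗ[ℂ] (Fin n → ℂ))
    (hK : ∀ x i, K (C.B x x) i = eval x (F i)) :
    ∃ P : HomTuple n, P.deg = 2 ∧ (∀ x i, eval x (P.poly i) = C.B x x i) ∧
      ∀ i, F i = ∑ j, MvPolynomial.C (LinearMap.toMatrix' K.toLinearMap i j) * P.poly j := by
  have hP : ∀ x i, eval x (∑ j, MvPolynomial.C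
      (LinearMap.toMatrix' K.symm.toLinearMap i j) * F j) = C.B x x i := by
    intro x i
    rw [eval_sum_toMatrix]
    have : (fun j => eval x (F j)) = K (C.B x x) := funext fun j => (hK x j).symm
    rw [this]
    simp
  refine ⟨⟨2, fun i => ∑ j, MvPolynomial.C (LinearMap.toMatrix' K.symm.toLinearMap i j) * F j,
    fun i => IsHomogeneous.sum _ _ _ fun j _ => (hF j).C_mul _, ?_⟩, rfl, hP, fun i => ?_⟩
  · by_contra! h0
    apply C.e_ne_zero
    rw [← C.B_e_e]
    ext i
    rw [← hP, h0, map_zero]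
    rfl
  · apply MvPolynomial.funext
    intro x
    rw [eval_sum_toMatrix, ← hK]
    have : C.B x x = fun j => eval x (∑ k, MvPolynomial.C
      (LinearMap.toMatrix' K.symm.toLinearMap j k) * F k) := _root_.funext fun j => (hP x j).symm
    rw [this]
    rfl

end Cremona

/-! ### The main theorem -/

theorem theorem3p3 (n : ℕ) [NeZero n] (f : RatMap n) (hf : f.IsQuadroQuadric) :
    ∃ (J : Type) (_ : NonAssocCommRing J) (_ : Module ℂ J) (_ : IsScalarTower ℂ J J)
      (_ : SMulCommClass ℂ J J) (_ : IsCommJordan J) (D : GenericCubic J)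
      (b : Module.Basis (Fin n) ℂ J) (σ : RatMap n),
      HasRank J 3 ∧ D.IsAdjointMap b σ ∧ σ.IsQuadroQuadric ∧ RatMap.LinearlyEquivalent σ f ∧
        RatMap.IsComp σ σ (RatMap.identity n) := by
  obtain ⟨F, G, N, M, rfl, h⟩ := hf.exists_pair
  obtain ⟨C, K, hK⟩ := h.exists_cubicNorm F.nonzero
  obtain ⟨P, dP, hP, hFP⟩ := C.exists_homTuple F.poly h.homF K hK
  have hn : 2 ≤ n := two_le_of_coprime h.homF F.nonzero h.coprime
  have cP : ∀ p, (∀ i, p ∣ P.poly i) → IsUnit p := fun p hp => h.coprime p fun i => by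
    rw [hFP]
    exact Finset.dvd_sum fun j _ => (hp j).mul_left _
  have hPv : ∀ x, (fun i => eval x (P.poly i)) = C.B x x := fun x => funext (hP x)
  -- Otherwise the linear form `α` divides every coordinate of the adjoint; it vanishes at 0, so it
  -- is not a unit, against coprimality.
  have hrank : ∃ x, LinearIndependent ℂ ![C.e, x, C.B x x] := by
    by_contra! hdep
    obtain ⟨α, L, hαL⟩ := C.exists_factor_of_dependent (by simpa using hn) hdep
    have hu : IsUnit α.toMvPolynomialForm := cP _ fun i => by
      refine ⟨((LinearMap.proj i).comp L).toMvPolynomialForm, MvPolynomial.funext fun x => ?_⟩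
      rw [hP, hαL, map_mul, LinearMap.eval_toMvPolynomialForm, LinearMap.eval_toMvPolynomialForm]
      rfl
    have := hu.map (eval (0 : Fin n → ℂ))
    rw [LinearMap.eval_toMvPolynomialForm, map_zero] at this
    exact not_isUnit_zero this
  have hcomp : RatMap.IsComp P.toRatMap P.toRatMap (RatMap.identity n) := by
    have he : ∀ x i, eval x (bind₁ P.poly (P.poly i)) = C.T x (C.B x x) / 3 * x i := by
      intro x i
      rw [eval_bind₁, hP, hPv, C.B_B]
      rfl
    refine ⟨P, P, ?_, rfl, rfl, Quotient.sound fun i j => ?_⟩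
    · by_contra! h0
      apply C.e_ne_zero
      ext i
      have := he C.e i
      rw [h0, C.B_e_e, C.T_e_e] at this
      simpa using this.symm
    · rw [ofMatrix_one_poly, ofMatrix_one_poly]
      apply MvPolynomial.funext
      intro x
      change eval x (bind₁ P.poly (P.poly i) * X j) = eval x (bind₁ P.poly (P.poly j) * X i)
      rw [map_mul, map_mul, he, he, eval_X, eval_X]
      ring
  have hdeg : P.toRatMap.HasDegree 2 := ⟨P, rfl, dP, cP⟩
  obtain ⟨x₀, hx₀⟩ := hrank
  let b : Module.Basis (Fin n) ℂ C.Algebra := (Pi.basisFun ℂ (Fin n) : Module.Basis _ _ _)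
  refine ⟨C.Algebra, inferInstance, inferInstance, inferInstance, inferInstance, inferInstance,
    C.genericCubic, b, P.toRatMap, C.hasRank_three hx₀, ⟨P, rfl, fun x i => ?_⟩,
    ⟨P.toRatMap, ⟨hcomp, hcomp⟩, hdeg, hdeg⟩, ?_, hcomp⟩
  · exact (hP x i).trans (congrFun (C.genericCubic_adjoint x) i).symm
  · have hX : (HomTuple.ofMatrix (1 : GL (Fin n) ℂ)).poly = X := funext ofMatrix_one_poly
    let A : GL (Fin n) ℂ := ⟨LinearMap.toMatrix' K.toLinearMap,
      LinearMap.toMatrix' K.symm.toLinearMap,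
      by rw [← LinearMap.toMatrix'_comp]; simp, by rw [← LinearMap.toMatrix'_comp]; simp⟩
    have hA : ∀ i, bind₁ P.poly ((HomTuple.ofMatrix A).poly i) = F.poly i := by
      intro i
      rw [hFP]
      simp [HomTuple.ofMatrix, A]
    -- Only the target is changed: `F = K ∘ P`, so the second projective transformation is the
    -- identity.
    refine ⟨A, 1, P.toRatMap, ⟨P, HomTuple.ofMatrix 1, ?_, rfl, rfl, Quotient.sound fun i j => ?_⟩,
      ⟨HomTuple.ofMatrix A, P, ?_, rfl, rfl, Quotient.sound fun i j => ?_⟩⟩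
    · obtain ⟨i, hi⟩ := P.nonzero
      exact ⟨i, by simpa [hX] using hi⟩
    · simp [HomTuple.comp, hX, mul_comm]
    · obtain ⟨i, hi⟩ := F.nonzero
      exact ⟨i, by rwa [hA]⟩
    · simp only [HomTuple.comp, hA, mul_comm]
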